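/- Let $\mathbb{H}$ be the real quaternions, and let $U(\mathbb{H})$ be the group of unit quaternions. Consider the following finite subgroups of $U(\mathbb{H})$: the binary polyhedral groups $$\mathcal{T}=\Bigl\langle i,\tfrac{1+i+j+k}{2}\Bigr\rangle,\quad \mathcal{O}=\Bigl\langle \tfrac{1+i}{\sqrt2},\tfrac{1+i+j+k}{2}\Bigr\rangle,\quad \mathcal{I}=\Bigl\langle i,\tfrac{1+i+j+k}{2},\tfrac{1+\tau i+\sigma j}{2}\Bigr\rangle,\qquad \tau=\tfrac{1+\sqrt5}{2},\ \sigma=\tfrac{1-\sqrt5}{2},$$ and the dicyclic groups $\mathcal{D}_n=\langle e^{\pi i/n},j\rangle$ of order $4n$, $n\ge 2$. Let $K$ be a finite subgroup of $U(\mathbb{H})$. A subset $L\subset K$ is a reflection system for $K$ if $L$ generates $K$, $1\in L$, and $ab^{-1}a\in L$ for all $a,b\in L$. Given a reflection system $L$ for $K$ and a normal subgroup $H$ of $K$ with $H\subset L$ and $LH=L$, let $G(K,L,H)$ be the group of unitary $2\times2$ quaternionic matrices generated by $$\begin{pmatrix}h&0\\0&1\end{pmatrix},\ \begin{pmatrix}1&0\\0&h\end{pmatrix}\quad(h\in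 H),\qquad \begin{pmatrix}0&b\\b^{-1}&0\end{pmatrix}\quad(b\in L).$$ It is said to be in canonical form, and is then denoted by $G_K(L,H)$, if $L$ gives all of its nondiagonal reflections, i.e., if $$L=\Bigl\{b\in K:\begin{pmatrix}0&b\\b^{-1}&0\end{pmatrix}\in G(K,L,H)\Bigr\}.$$ Proposition. Let $G_K(L,H)$ and $G_{K'}(L',H')$ be reflection groups in canonical form, where $K\in\{\mathcal{T},\mathcal{O},\mathcal{I}\}$ and $K'=\mathcal{D}_n$ for some $n\ge2$. Then $G_K(L,H)$ and $G_{K'}(L',H')$ are not isomorphic as groups. -/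

import Mathlib

open scoped Quaternion

namespace QuatRefl

noncomputable section

/-- `U(ℍ)`, the group of unit quaternions. -/
abbrev UH : Type := unitary ℍ[ℝ]

/-- `U(ℍ²)`, the group of unitary `2 × 2` matrices over the quaternions. -/
abbrev UH2 : Type := unitary (Matrix (Fin 2) (Fin 2) ℍ[ℝ])

/-- The quaternion `a + b i + c j + d k`. -/
def quat (a b c d : ℝ) : ℍ[ℝ] := ⟨a, b, c, d⟩

/-- The unit quaternion `a + b i + c j + d k`. -/
def unitQuat (a b c d : ℝ) (h : a ^ 2 + b ^ 2 + c ^ 2 + d ^ 2 = 1) : UH :=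
  ⟨quat a b c d, by
    have h' : Quaternion.normSq (quat a b c d) = 1 := by
      rw [Quaternion.normSq_def']; exact h
    rw [Unitary.mem_iff, Quaternion.star_mul_self, Quaternion.self_mul_star, h']
    simp⟩

/-- The quaternion `i`. -/
def qi : UH := unitQuat 0 1 0 0 (by norm_num)

/-- The quaternion `j`. -/
def qj : UH := unitQuat 0 0 1 0 (by norm_num)

/-- The quaternion `(1 + i + j + k) / 2`. -/
def qζ : UH := unitQuat (1 / 2) (1 / 2) (1 / 2) (1 / 2) (by norm_num)

/-- The quaternion `(1 + i) / √2`. -/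
def qρ : UH := unitQuat (1 / √2) (1 / √2) 0 0 (by
  rw [div_pow, Real.sq_sqrt (by norm_num)]; norm_num)

/-- The quaternion `(1 + τ i + σ j) / 2`, where `τ = (1 + √5) / 2` and `σ = (1 - √5) / 2`. -/
def qη : UH := unitQuat (1 / 2) ((1 + √5) / 2 / 2) ((1 - √5) / 2 / 2) 0 (by
  nlinarith [Real.sq_sqrt (show (0 : ℝ) ≤ 5 by norm_num)])

/-- The quaternion `ω = e ^ (π i / n) = cos (π / n) + sin (π / n) i`. -/
def qω (n : ℕ) : UH := unitQuat (Real.cos (Real.pi / n)) (Real.sin (Real.pi / n)) 0 0 (by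
  linarith [Real.cos_sq_add_sin_sq (Real.pi / n)])

/-- The binary tetrahedral group. -/
def binaryTetrahedral : Subgroup UH := Subgroup.closure {qi, qζ}

/-- The binary octahedral group. -/
def binaryOctahedral : Subgroup UH := Subgroup.closure {qρ, qζ}

/-- The binary icosahedral group. -/
def binaryIcosahedral : Subgroup UH := Subgroup.closure {qi, qζ, qη}

/-- The dicyclic (binary dihedral) group of order `4 n`, for `n ≥ 2`. -/
def dicyclic (n : ℕ) : Subgroup UH := Subgroup.closure {qω n, qj}

/-- The unitary matrix `diag (a, b)`. -/
def diagMat (a b : UH) : UH2 :=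
  ⟨!![(a : ℍ[ℝ]), 0; 0, (b : ℍ[ℝ])], by
    rw [Unitary.mem_iff]
    constructor <;> ext1 p q <;> fin_cases p <;> fin_cases q <;>
      simp [Matrix.mul_apply, Matrix.star_eq_conjTranspose, Matrix.conjTranspose_apply]⟩

/-- The unitary matrix with rows `(0, b)` and `(b⁻¹, 0)`. -/
def antidiagRefl (b : UH) : UH2 :=
  ⟨!![0, (b : ℍ[ℝ]); ((b⁻¹ : UH) : ℍ[ℝ]), 0], by
    rw [Unitary.mem_iff]
    constructor <;> ext1 p q <;> fin_cases p <;> fin_cases q <;>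
      simp [Matrix.mul_apply, Matrix.star_eq_conjTranspose, Matrix.conjTranspose_apply]⟩

/-- `L` is a reflection system for the subgroup `K`: it contains `1`, is closed under
`(a, b) ↦ a b⁻¹ a`, and generates `K`. -/
structure IsReflectionSystem {U : Type*} [Group U] (K : Subgroup U) (L : Set U) : Prop where
  one_mem : 1 ∈ L
  circ_mem : ∀ a ∈ L, ∀ b ∈ L, a * b⁻¹ * a ∈ L
  closure_eq : Subgroup.closure L = K

/-- The group `G(K, L, H)`, generated by the diagonal matrices `diag (h, 1)`, `diag (1, h)`,
`h ∈ H`, and the nondiagonal reflections given by the elements of `L`. (The group `K` enters only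
as the group generated by `L`.) -/
def reflGroup (L : Set UH) (H : Subgroup UH) : Subgroup UH2 :=
  Subgroup.closure
    ({g | ∃ h ∈ H, g = diagMat h 1} ∪ {g | ∃ h ∈ H, g = diagMat 1 h} ∪
      {g | ∃ b ∈ L, g = antidiagRefl b})

/-- `(K, L, H)` labels a reflection group `G(K, L, H)`: `L` is a reflection system for `K`,
`H` is a normal subgroup of `K` contained in `L`, and `L H = L`. -/
structure IsLabel (K : Subgroup UH) (L : Set UH) (H : Subgroup UH) : Prop where
  system : IsReflectionSystem K L
  le : H ≤ K
  normal : (H.subgroupOf K).Normal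
  subset : (H : Set UH) ⊆ L
  mul_mem : ∀ b ∈ L, ∀ h ∈ H, b * h ∈ L

/-- The set `L_G` of those `b ∈ K` whose nondiagonal reflection lies in `G = G(K, L, H)`. -/
def nondiagonal (K : Subgroup UH) (L : Set UH) (H : Subgroup UH) : Set UH :=
  {b | b ∈ K ∧ antidiagRefl b ∈ reflGroup L H}

/-- `G(K, L, H)` is in canonical form, and so is denoted by `G_K(L, H)`: all its nondiagonal
reflections are given by `L`, that is, `L = L_G`. -/
structure IsCanonicalForm (K : Subgroup UH) (L : Set UH) (H : Subgroup UH) : Prop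
    extends IsLabel K L H where
  eq_nondiagonal : L = nondiagonal K L H

end

end QuatRefl

namespace QuatRefl

noncomputable section

/-! The two groups are separated by a group law: "any two fourth powers commute". It holds on the
dicyclic side. The square of a monomial matrix is diagonal, and `dicyclic n` lies in U(ℂ) ∪ U(ℂ)j,
whose squares are complex; so fourth powers are diagonal with complex entries
(`commute_pow_four_of_mem_reflGroup`). It fails on the polyhedral side. The diagonal matrices of the
group project onto `K` in the first entry (`exists_diagHom_mem_reflGroup`), and each polyhedral `K`
contains `qζ` and its conjugate by `qi`, whose fourth powers do not commute
(`not_commute_qζ_pow_four`). -/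

theorem quat_mul_quat (a b c d a' b' c' d' : ℝ) : quat a b c d * quat a' b' c' d' =
    quat (a * a' - b * b' - c * c' - d * d') (a * b' + b * a' + c * d' - d * c')
      (a * c' - b * d' + c * a' + d * b') (a * d' + b * c' - c * b' + d * a') := by
  apply Quaternion.ext
  · exact Quaternion.re_mul _ _
  · exact Quaternion.imI_mul _ _
  · exact Quaternion.imJ_mul _ _
  · exact Quaternion.imK_mul _ _

theorem star_quat (a b c d : ℝ) : star (quat a b c d) = quat a (-b) (-c) (-d) := by
  apply Quaternion.ext
  · exact Quaternion.re_star _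
  · exact Quaternion.imI_star _
  · exact Quaternion.imJ_star _
  · exact Quaternion.imK_star _

/-- The subgroup `U(ℂ) ∪ U(ℂ) j` of `U(ℍ)`. -/
def complexMonomial : Subgroup UH where
  carrier := {u | ((u : ℍ[ℝ]).imJ = 0 ∧ (u : ℍ[ℝ]).imK = 0) ∨
    ((u : ℍ[ℝ]).re = 0 ∧ (u : ℍ[ℝ]).imI = 0)}
  one_mem' := by simp
  mul_mem' := by
    rintro a b (⟨h1, h2⟩ | ⟨h1, h2⟩) (⟨h3, h4⟩ | ⟨h3, h4⟩) <;>
      simp [h1, h2, h3, h4]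
  inv_mem' := by
    rintro a (⟨h1, h2⟩ | ⟨h1, h2⟩) <;> simp [← Unitary.star_eq_inv, h1, h2]

theorem dicyclic_le_complexMonomial (n : ℕ) : dicyclic n ≤ complexMonomial := by
  rw [dicyclic, Subgroup.closure_le]
  rintro x (rfl | rfl)
  · exact Or.inl ⟨rfl, rfl⟩
  · exact Or.inr ⟨rfl, rfl⟩

/-- The square of an element of `U(ℂ) ∪ U(ℂ) j` is a complex number. -/
theorem imJ_imK_sq_of_mem_complexMonomial {u : UH} (hu : u ∈ complexMonomial) :
    ((u ^ 2 : UH) : ℍ[ℝ]).imJ = 0 ∧ ((u ^ 2 : UH) : ℍ[ℝ]).imK = 0 := by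
  -- In the second case `u` is a pure unit quaternion, so its square is -1.
  rcases hu with ⟨h1, h2⟩ | ⟨h1, h2⟩ <;> simp [sq, h1, h2]

theorem commute_of_imJ_imK {u v : UH} (hu : (u : ℍ[ℝ]).imJ = 0 ∧ (u : ℍ[ℝ]).imK = 0)
    (hv : (v : ℍ[ℝ]).imJ = 0 ∧ (v : ℍ[ℝ]).imK = 0) : Commute u v := by
  apply Subtype.ext
  ext <;> simp [hu.1, hu.2, hv.1, hv.2] <;> ring

theorem diagMat_mul (a b c d : UH) : diagMat a b * diagMat c d = diagMat (a * c) (b * d) := by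
  apply Subtype.ext
  ext1 p q
  fin_cases p <;> fin_cases q <;> simp [diagMat]

theorem diagMat_one : diagMat 1 1 = 1 := by
  apply Subtype.ext
  ext1 p q
  fin_cases p <;> fin_cases q <;> simp [diagMat]

/-- The diagonal matrices, as a homomorphism from `U(ℍ) × U(ℍ)`. -/
def diagHom : UH × UH →* UH2 where
  toFun p := diagMat p.1 p.2
  map_one' := diagMat_one
  map_mul' p q := (diagMat_mul p.1 p.2 q.1 q.2).symm

theorem diagHom_injective : Function.Injective diagHom := by
  rintro ⟨a, b⟩ ⟨c, d⟩ h
  have h' := congrArg Subtype.val h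
  have h0 := congrFun (congrFun h' 0) 0
  have h1 := congrFun (congrFun h' 1) 1
  exact Prod.ext (Subtype.ext (by simpa [diagHom, diagMat] using h0))
    (Subtype.ext (by simpa [diagHom, diagMat] using h1))

/-- The coordinate swap. -/
def swapMat : UH2 := antidiagRefl 1

theorem swapMat_mul_self : swapMat * swapMat = 1 := by
  apply Subtype.ext
  ext1 p q
  fin_cases p <;> fin_cases q <;> simp [swapMat, antidiagRefl]

theorem swapMat_mul_diagHom (p : UH × UH) : swapMat * diagHom p = diagHom p.swap * swapMat := by
  apply Subtype.ext
  ext1 r s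
  fin_cases r <;> fin_cases s <;>
    simp [swapMat, antidiagRefl, diagHom, diagMat]

theorem antidiagRefl_eq (b : UH) : antidiagRefl b = diagHom (b, b⁻¹) * swapMat := by
  apply Subtype.ext
  ext1 p q
  fin_cases p <;> fin_cases q <;>
    simp [swapMat, antidiagRefl, diagHom, diagMat]

/-- Every element of `G(K, L, H)` is a monomial matrix with nonzero entries in `K`. -/
theorem exists_eq_of_mem_reflGroup {K : Subgroup UH} {L : Set UH} {H : Subgroup UH}
    (hL : L ⊆ K) (hH : H ≤ K) {g : UH2} (hg : g ∈ reflGroup L H) :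
    ∃ p ∈ K.prod K, g = diagHom p ∨ g = diagHom p * swapMat := by
  induction hg using Subgroup.closure_induction with
  | mem x hx =>
    rcases hx with (⟨h, hh, rfl⟩ | ⟨h, hh, rfl⟩) | ⟨b, hb, rfl⟩
    · exact ⟨(h, 1), ⟨hH hh, K.one_mem⟩, Or.inl rfl⟩
    · exact ⟨(1, h), ⟨K.one_mem, hH hh⟩, Or.inl rfl⟩
    · exact ⟨(b, b⁻¹), ⟨hL hb, K.inv_mem (hL hb)⟩, Or.inr (antidiagRefl_eq b)⟩
  | one => exact ⟨1, one_mem _, Or.inl (map_one _).symm⟩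
  | mul x y _ _ hx hy =>
    obtain ⟨p, hp, rfl | rfl⟩ := hx <;> obtain ⟨q, hq, rfl | rfl⟩ := hy
    · exact ⟨p * q, mul_mem hp hq, Or.inl (map_mul _ _ _).symm⟩
    · exact ⟨p * q, mul_mem hp hq, Or.inr (by rw [map_mul, mul_assoc])⟩
    · exact ⟨p * q.swap, mul_mem hp ⟨hq.2, hq.1⟩, Or.inr (by
        rw [map_mul, mul_assoc, swapMat_mul_diagHom, mul_assoc])⟩
    · exact ⟨p * q.swap, mul_mem hp ⟨hq.2, hq.1⟩, Or.inl (by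
        rw [map_mul, mul_assoc, ← mul_assoc swapMat, swapMat_mul_diagHom, mul_assoc,
          swapMat_mul_self, mul_one])⟩
  | inv x _ hx =>
    obtain ⟨p, hp, rfl | rfl⟩ := hx
    · exact ⟨p⁻¹, inv_mem hp, Or.inl (map_inv _ _).symm⟩
    · refine ⟨p⁻¹.swap, ⟨(inv_mem hp).2, (inv_mem hp).1⟩, Or.inr ?_⟩
      rw [← swapMat_mul_diagHom, mul_inv_rev, map_inv, inv_eq_of_mul_eq_one_left swapMat_mul_self]

/-- Moving `swapMat` past a diagonal matrix exchanges the entries, so the square of `diagHom (a, b)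
* swapMat` is `diagHom (a * b, b * a)`. -/
theorem exists_sq_eq_of_mem_reflGroup {K : Subgroup UH} {L : Set UH} {H : Subgroup UH}
    (hL : L ⊆ K) (hH : H ≤ K) {g : UH2} (hg : g ∈ reflGroup L H) :
    ∃ p ∈ K.prod K, g ^ 2 = diagHom p := by
  obtain ⟨p, hp, rfl | rfl⟩ := exists_eq_of_mem_reflGroup hL hH hg
  · exact ⟨p ^ 2, pow_mem hp 2, (map_pow _ _ _).symm⟩
  · refine ⟨p * p.swap, mul_mem hp ⟨hp.2, hp.1⟩, ?_⟩
    rw [sq, map_mul, mul_assoc, ← mul_assoc swapMat, swapMat_mul_diagHom, mul_assoc,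
      swapMat_mul_self, mul_one]

/-- If `K` is dicyclic then the fourth powers of the elements of `G(K, L, H)` commute. -/
theorem commute_pow_four_of_mem_reflGroup {L : Set UH} {H : Subgroup UH}
    (hL : L ⊆ complexMonomial) (hH : H ≤ complexMonomial) {g g' : UH2}
    (hg : g ∈ reflGroup L H) (hg' : g' ∈ reflGroup L H) : Commute (g ^ 4) (g' ^ 4) := by
  obtain ⟨p, hp, h⟩ := exists_sq_eq_of_mem_reflGroup hL hH hg
  obtain ⟨q, hq, h'⟩ := exists_sq_eq_of_mem_reflGroup hL hH hg'
  -- The first squaring makes the matrix diagonal, the second makes its entries complex.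
  rw [show 4 = 2 * 2 from rfl, pow_mul, pow_mul, h, h', ← map_pow, ← map_pow]
  refine Commute.map (Commute.prod ?_ ?_) diagHom
  · exact commute_of_imJ_imK (imJ_imK_sq_of_mem_complexMonomial hp.1)
      (imJ_imK_sq_of_mem_complexMonomial hq.1)
  · exact commute_of_imJ_imK (imJ_imK_sq_of_mem_complexMonomial hp.2)
      (imJ_imK_sq_of_mem_complexMonomial hq.2)

/-- Every element of `K` is the first entry of a diagonal matrix in `G(K, L, H)`. -/
theorem exists_diagHom_mem_reflGroup {K : Subgroup UH} {L : Set UH} (H : Subgroup UH)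
    (hL : IsReflectionSystem K L) {x : UH} (hx : x ∈ K) :
    ∃ y, diagHom (x, y) ∈ reflGroup L H := by
  -- The first entries that occur form a subgroup, so it is enough to reach the generators `b ∈ L`;
  -- the product of `antidiagRefl b` and `swapMat` is `diagHom (b, b⁻¹)`.
  suffices K ≤ ((reflGroup L H).comap diagHom).map (MonoidHom.fst UH UH) by
    obtain ⟨⟨_, y⟩, hy, rfl⟩ := this hx
    exact ⟨y, hy⟩
  rw [← hL.closure_eq, Subgroup.closure_le]
  intro b hb
  refine ⟨(b, b⁻¹), ?_, rfl⟩
  have h1 : swapMat ∈ reflGroup L H := Subgroup.subset_closure (Or.inr ⟨1, hL.one_mem, rfl⟩)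
  have hb : antidiagRefl b ∈ reflGroup L H := Subgroup.subset_closure (Or.inr ⟨b, hb, rfl⟩)
  have h := mul_mem hb h1
  rwa [antidiagRefl_eq, mul_assoc, swapMat_mul_self, mul_one] at h

theorem qρ_sq : qρ ^ 2 = qi := by
  apply Subtype.ext
  have h : (√2)⁻¹ * (√2)⁻¹ = (1 / 2 : ℝ) := by
    rw [← mul_inv, Real.mul_self_sqrt (by norm_num), one_div]
  simp [sq, qρ, qi, unitQuat, quat_mul_quat, h]
  norm_num

/-- Since ζ³ = -1, the fourth powers are -ζ and -iζi⁻¹ = -(1 + i - j - k)/2. Their two products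
already differ in the `j` coordinate. -/
theorem not_commute_qζ_pow_four : ¬ Commute (qζ ^ 4) ((qi * qζ * qi⁻¹) ^ 4) := by
  rw [conj_pow]
  have h4 : ((qζ ^ 4 : UH) : ℍ[ℝ]) = quat (-1 / 2) (-1 / 2) (-1 / 2) (-1 / 2) := by
    simp only [pow_succ, pow_zero, one_mul, Submonoid.coe_mul, qζ, unitQuat, quat_mul_quat]
    norm_num
  intro h
  have h' := congrArg (fun u : UH ↦ (u : ℍ[ℝ]).imJ) h.eq
  simp only [Submonoid.coe_mul, h4, ← Unitary.star_eq_inv, Unitary.coe_star, qi, unitQuat,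
    quat_mul_quat, star_quat] at h'
  norm_num [quat] at h'

theorem qi_mem_and_qζ_mem {K : Subgroup UH}
    (hK : K = binaryTetrahedral ∨ K = binaryOctahedral ∨ K = binaryIcosahedral) :
    qi ∈ K ∧ qζ ∈ K := by
  rcases hK with rfl | rfl | rfl
  · exact ⟨Subgroup.subset_closure (by simp), Subgroup.subset_closure (by simp)⟩
  · refine ⟨?_, Subgroup.subset_closure (by simp)⟩
    rw [← qρ_sq]
    exact pow_mem (Subgroup.subset_closure (by simp)) 2
  · exact ⟨Subgroup.subset_closure (by simp), Subgroup.subset_closure (by simp)⟩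

end

end QuatRefl

theorem mainTheorem9
    (K : Subgroup QuatRefl.UH)
    (hK : K = QuatRefl.binaryTetrahedral ∨ K = QuatRefl.binaryOctahedral ∨
      K = QuatRefl.binaryIcosahedral)
    (L : Set QuatRefl.UH) (H : Subgroup QuatRefl.UH)
    (hG : QuatRefl.IsCanonicalForm K L H)
    (n : ℕ) (hn : 2 ≤ n)
    (L' : Set QuatRefl.UH) (H' : Subgroup QuatRefl.UH)
    (hG' : QuatRefl.IsCanonicalForm (QuatRefl.dicyclic n) L' H') :
    IsEmpty (QuatRefl.reflGroup L H ≃* QuatRefl.reflGroup L' H') := by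
  open QuatRefl in
  refine ⟨fun e ↦ not_commute_qζ_pow_four ?_⟩
  obtain ⟨hi, hζ⟩ := qi_mem_and_qζ_mem hK
  -- The second entries `y` and `z` are not controlled; only first entries are compared at the end.
  obtain ⟨y, hy⟩ := exists_diagHom_mem_reflGroup H hG.system hζ
  obtain ⟨z, hz⟩ := exists_diagHom_mem_reflGroup H hG.system
    (mul_mem (mul_mem hi hζ) (inv_mem hi))
  have hK' := dicyclic_le_complexMonomial n
  have hL' : L' ⊆ complexMonomial := fun b hb ↦ hK' <| by
    rw [← hG'.system.closure_eq]
    exact Subgroup.subset_closure hb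
  have h : Commute (e ⟨_, hy⟩ ^ 4) (e ⟨_, hz⟩ ^ 4) := Subtype.ext
    (commute_pow_four_of_mem_reflGroup hL' (hG'.le.trans hK') (e ⟨_, hy⟩).2 (e ⟨_, hz⟩).2)
  rw [← map_pow, ← map_pow] at h
  have h' := congrArg Subtype.val (e.injective
    ((map_mul e _ _).trans (h.eq.trans (map_mul e _ _).symm)))
  simp only [Subgroup.coe_mul, Subgroup.coe_pow, ← map_pow, ← map_mul] at h'
  exact congrArg Prod.fst (diagHom_injective h')
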